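/- **Conventions.** A *$k$-uniform weighted simplicial complex* $X$ ($k\ge 1$) consists of a finite family $X(k)$ of $k$-element sets together with all their subsets (*faces*), and a probability density $\Pr_k: X(k)\to(0,1]$. Write $X(j)$ for the faces of size $j$ (vertices are identified with singletons), with the induced density $\Pr_j(t)=\binom{k}{j}^{-1}\sum_{s\in X(k),\,s\supseteq t}\Pr_k(s)$. The link of a face $s$ is the $(k-|s|)$-uniform complex $X_s=\{t\setminus s: t\in X,\ t\supseteq s\}$ with density $\Pr^s[t]=\Pr_k(t\cup s)/\big(\Pr_{|s|}(s)\binom{k}{|s|}\big)$ on its top-level faces $t$. The graph underlying a complex $Y$ has vertices $Y(1)$, edges $Y(2)$ and edge weights $\Pr_2$; its normalized adjacency operator is $Ag(v)=\sum_{u\sim v}\frac{\Pr_2(uv)}{\sum_{w\sim v}\Pr_2(wv)}\,g(u)$, with eigenvalues $1=\lambda_1\ge\lambda_2\ge\dots\ge\lambda_{|Y(1)|}$ counted with multiplicity. $X$ is a *$\lambda$-two-sided local-spectral expander* if for every face $s$ with $|s|\le k-2$ (including $s=\emptyset$) the graph underlying $X_s$ satisfies $\lambda_2\le\lambda$ and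 $\lambda_{|X_s(1)|}\ge-\lambda$. **Theorem (Chernoff–Hoeffding for high dimensional expanders).** Let $k\ge1$, let $\alpha\in[0,1]$, and let $X$ be a $k$-uniform weighted simplicial complex that is a $\frac1k2^{-k^\alpha}$-two-sided local-spectral expander. Put $$c_\alpha=\exp\!\left(\frac{(3/\alpha)^{1/\alpha}}{e^{\alpha}}\right)\ \text{ for }\alpha>0,\qquad c_0=\infty .$$ Then for every $f:X(1)\to[0,1]$ with mean $\mu=\mathbb E_{v\sim\Pr_1}[f(v)]$ and every $\varepsilon>0$, both tails of the average of $f$ over a random $k$-face satisfy $$\Pr_{\{v_1,\dots,v_k\}\sim\Pr_k}\left[\frac1k\sum_{i=1}^k f(v_i)-\mu>\varepsilon\right]\le 2\min\{k,c_\alpha\}\exp\left(-\tfrac1{12}\varepsilon^2k^{\frac{1+\alpha}{2}}\right)$$ and $$\Pr_{\{v_1,\dots,v_k\}\sim\Pr_k}\left[\frac1k\sum_{i=1}^k f(v_i)-\mu<-\varepsilon\right]\le 2\min\{k,c_\alpha\}\exp\left(-\tfrac1{12}\varepsilon^2k^{\frac{1+\alpha}{2}}\right).$$ (So $\alpha=0$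 gives $2k\exp(-\frac1{12}\varepsilon^2\sqrt k)$ for $\frac1{2k}$-two-sided expanders, and $\alpha=1$ gives the Chernoff-type bound $2e^{3/e}\exp(-\frac1{12}\varepsilon^2k)$ for $\frac1k2^{-k}$-two-sided expanders.) -/

import Mathlib

open Finset

/-- A pure `d`-uniform simplicial complex on (finitely many elements of) the ground type `V`,
together with a density on its top-level faces. It is presented by its `d`-element faces; the
faces of the complex are all subsets of these. Values of `prob` off `facets` are irrelevant. -/
structure WeightedComplex (V : Type*) [DecidableEq V] (d : ℕ) where
  /-- the top-level faces `X(d)` -/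
  facets : Finset (Finset V)
  card_of_mem : ∀ s ∈ facets, s.card = d
  /-- the density `Pr_d` on `X(d)` -/
  prob : Finset V → ℝ
  prob_pos : ∀ s ∈ facets, 0 < prob s
  prob_sum : ∑ s ∈ facets, prob s = 1

namespace WeightedComplex

variable {V : Type*} [DecidableEq V] {d : ℕ}

/-- `s` is a face of `X` (of any size, including the empty face). -/
def IsFace (X : WeightedComplex V d) (s : Finset V) : Prop :=
  ∃ t ∈ X.facets, s ⊆ t

/-- `X(j)`, the set of faces of size `j`. -/
def faces (X : WeightedComplex V d) (j : ℕ) : Finset (Finset V) :=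
  X.facets.biUnion fun s => s.powersetCard j

/-- The vertices of `X`, that is `X(1)` with `{v}` identified with `v`. -/
def vertices (X : WeightedComplex V d) : Finset V :=
  X.facets.biUnion fun s => s

/-- The induced density `Pr_j` on `X(j)`: draw `s ∼ Pr_d`, then a uniformly random `j`-subset
of `s`. -/
noncomputable def density (X : WeightedComplex V d) (j : ℕ) (t : Finset V) : ℝ :=
  (1 / (d.choose j : ℝ)) * ∑ s ∈ X.facets with t ⊆ s, X.prob s

theorem card_le_of_isFace (X : WeightedComplex V d) {s : Finset V} (hs : X.IsFace s) :
    s.card ≤ d := by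
  obtain ⟨t, ht, hst⟩ := hs
  exact (card_le_card hst).trans_eq (X.card_of_mem t ht)

theorem density_mul_choose (X : WeightedComplex V d) {s : Finset V} (hs : X.IsFace s) :
    X.density s.card s * (d.choose s.card : ℝ) = ∑ t ∈ X.facets with s ⊆ t, X.prob t := by
  have h : (d.choose s.card : ℝ) ≠ 0 := by
    exact_mod_cast (Nat.choose_pos (X.card_le_of_isFace hs)).ne'
  unfold density
  field_simp

theorem sum_prob_pos (X : WeightedComplex V d) {s : Finset V} (hs : X.IsFace s) :
    0 < ∑ t ∈ X.facets with s ⊆ t, X.prob t := by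
  obtain ⟨t, ht, hst⟩ := hs
  exact sum_pos (fun u hu => X.prob_pos u (mem_filter.1 hu).1) ⟨t, mem_filter.2 ⟨ht, hst⟩⟩

/-- The link `X_s = {t \ s : t ∈ X, s ⊆ t}` of a face `s`, with its induced density
`Pr^s[t] = Pr[t ∪ s] / (Pr[s] * (d choose |s|))`. -/
noncomputable def link (X : WeightedComplex V d) (s : Finset V) (hs : X.IsFace s) :
    WeightedComplex V (d - s.card) where
  facets := {t ∈ X.facets | s ⊆ t}.image fun t => t \ s
  card_of_mem := by
    intro u hu
    obtain ⟨t, ht, rfl⟩ := mem_image.1 hu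
    rw [mem_filter] at ht
    rw [card_sdiff_of_subset ht.2, X.card_of_mem t ht.1]
  prob t := X.prob (t ∪ s) / (X.density s.card s * (d.choose s.card : ℝ))
  prob_pos := by
    intro u hu
    obtain ⟨t, ht, rfl⟩ := mem_image.1 hu
    rw [mem_filter] at ht
    rw [density_mul_choose X hs, sdiff_union_of_subset ht.2]
    exact div_pos (X.prob_pos t ht.1) (X.sum_prob_pos hs)
  prob_sum := by
    rw [density_mul_choose X hs, sum_image, ← sum_div]
    · rw [sum_congr rfl (g := X.prob), div_self (X.sum_prob_pos hs).ne']
      intro t ht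
      rw [sdiff_union_of_subset (mem_filter.1 ht).2]
    · intro t ht u hu h
      have ht' : s ⊆ t := by simpa using (mem_filter.1 (mem_coe.1 ht)).2
      have hu' : s ⊆ u := by simpa using (mem_filter.1 (mem_coe.1 hu)).2
      rw [← sdiff_union_of_subset ht', ← sdiff_union_of_subset hu']
      exact congrArg (· ∪ s) h

/-- The normalized adjacency operator of the weighted graph `(X(1), X(2), Pr_2)` underlying `X`:
`A v u = Pr[uv] / ∑_{w ∼ v} Pr[wv]` if `uv` is an edge, and `0` otherwise. -/
noncomputable def adjMatrix (X : WeightedComplex V d) : Matrix X.vertices X.vertices ℝ :=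
  fun v u =>
    if {v.1, u.1} ∈ X.faces 2 then
      X.density 2 {v.1, u.1} /
        ∑ w ∈ X.vertices with {v.1, w} ∈ X.faces 2, X.density 2 {v.1, w}
    else 0

/-- The eigenvalues `1 = λ₁ ≥ λ₂ ≥ ⋯` of the normalized adjacency operator, counted with
multiplicity. -/
noncomputable def eigenvalues (X : WeightedComplex V d) : Multiset ℝ :=
  X.adjMatrix.charpoly.roots

/-- The graph underlying `X` is a `lam`-two-sided spectral expander: all its eigenvalues but one
copy of the trivial eigenvalue `λ₁ = 1` lie in `[-lam, lam]`, i.e. `λ₂ ≤ lam` and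
`-lam ≤ λ_{|V|}`. -/
def IsTwoSidedSpectralExpander (X : WeightedComplex V d) (lam : ℝ) : Prop :=
  ∀ μ ∈ X.eigenvalues.erase 1, -lam ≤ μ ∧ μ ≤ lam

/-- `X` is a `lam`-two-sided local-spectral expander: the graph underlying the link of every face
of size at most `d - 2` (including the empty face) is a `lam`-two-sided spectral expander. -/
def IsTwoSidedLocalSpectralExpander (X : WeightedComplex V d) (lam : ℝ) : Prop :=
  ∀ (s : Finset V) (hs : X.IsFace s), s.card + 2 ≤ d →
    (X.link s hs).IsTwoSidedSpectralExpander lam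

/-- The expectation of `f` over a random vertex. -/
noncomputable def vertexMean (X : WeightedComplex V d) (f : V → ℝ) : ℝ :=
  ∑ v ∈ X.vertices, X.density 1 {v} * f v

open Classical in
/-- The probability over `s ∼ Pr_d` of the event `E`. -/
noncomputable def facetProb (X : WeightedComplex V d) (E : Finset V → Prop) : ℝ :=
  ∑ s ∈ X.facets with E s, X.prob s

end WeightedComplex

/-- The constant `exp((3/α)^(1/α) / e^α)`, meaningful for `α > 0`. -/
noncomputable def chernoffConst (α : ℝ) : ℝ :=
  Real.exp ((3 / α) ^ (1 / α) / Real.exp α)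

/-- `min {k, c_α}`, where `c_0 = ∞`. -/
noncomputable def chernoffCoeff (k : ℕ) (α : ℝ) : ℝ :=
  if α = 0 then (k : ℝ) else min (k : ℝ) (chernoffConst α)

/-!
The average of `f` over a random facet concentrates because every exponential tilt of the complex
is still an expander.

Let `A s = ∑ v ∈ s, f v`. The second derivative of `log E[exp (t A)]` is the variance of `A` when
the facets are reweighted by `exp (t A)` (`expTilt`), so it suffices to bound this variance by
`3 k` for `0 ≤ t ≤ 1 / 6` (`sum_mul_exp_le_of_variance_le`). The variance of a sum of vertex values
is controlled by the second eigenvalue of the graph underlying the complex: a bound `2 / k` on it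
is enough (`exists_sum_sq_le_of_hasGap`).

The links of codimension two are graphs with second eigenvalue at most `1 / (2 k)` by assumption.
The tilt multiplies the weight of an edge `uv` of such a graph, up to a constant, by
`exp (t (f u + f v))`, which costs at most a factor `exp t` in the second eigenvalue since `f`
oscillates by at most one (`HasGap.tilt`). Oppenheim's trickling-down theorem
(`hasGap_of_hasGap_insert`) then carries the bound from the links of codimension two to the whole
tilted complex (`WeightedComplex.hasGap_expTilt`); the connectedness it needs does not depend on the
weights, hence follows from the expansion of the untilted links.

This gives both tails the bound `exp (-ε² k / 12)` as soon as the expansion parameter is at most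
`1 / (2 k)` (`WeightedComplex.facetProb_gt_le`), and `k ^ ((1 + α) / 2) ≤ k`.
-/

/-! ### Eigenvalues and quadratic forms of weighted graphs -/

section Spectral

variable {n : Type*} [Fintype n] [DecidableEq n]

/-- A Rayleigh-quotient bound for a symmetric weight matrix `W` with row sums `d`: if every
eigenvalue of the normalized operator `d⁻¹ W` having a nonzero eigenvector of mean zero is at most
`θ`, then the quadratic form of `W` is at most `θ` times that of `d` on functions of mean zero. -/
theorem sum_mul_mulVec_le_of_eigenvalue_le (W : n → n → ℝ) (hW : ∀ u v, W u v = W v u)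
    (d : n → ℝ) (hd : ∀ u, 0 < d u) (hrow : ∀ u, ∑ v, W u v = d u) {θ : ℝ} (hθ : 0 ≤ θ)
    (H : ∀ (γ : ℝ) (φ : n → ℝ), (∀ u, ∑ v, W u v * φ v = γ * (d u * φ u)) →
      ∑ u, d u * φ u = 0 → φ ≠ 0 → γ ≤ θ)
    (ψ : n → ℝ) (hψ : ∑ u, d u * ψ u = 0) :
    ∑ u, ψ u * ∑ v, W u v * ψ v ≤ θ * ∑ u, d u * ψ u ^ 2 := by
  set r : n → ℝ := fun u => √(d u) with hr
  have hr0 : ∀ u, 0 < r u := fun u => Real.sqrt_pos.2 (hd u)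
  have hrr : ∀ u, r u * r u = d u := fun u => Real.mul_self_sqrt (hd u).le
  set D := ∑ u, d u with hD
  -- The constants are removed by subtracting the rank-one matrix `d dᵀ / D`, so that every
  -- eigenvector with nonzero eigenvalue has mean zero.
  obtain ⟨M, hM⟩ : ∃ M : Matrix n n ℝ, ∀ u v,
      M u v = (if u = v then θ else 0) - (W u v - d u * d v / D) / (r u * r v) :=
    ⟨Matrix.of _, fun _ _ => rfl⟩
  have hMh : M.IsHermitian := by
    ext u v
    rw [Matrix.conjTranspose_apply, star_trivial, hM, hM, hW v u, mul_comm (r v),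
      mul_comm (d v)]
    simp only [eq_comm]
  have hMv : ∀ (φ : n → ℝ) (u : n), r u * (M.mulVec (fun v => r v * φ v)) u =
      θ * (d u * φ u) - (∑ v, W u v * φ v - d u * (∑ v, d v * φ v) / D) := by
    intro φ u
    have h1 : M.mulVec (fun v => r v * φ v) u =
        θ * (r u * φ u) - ∑ v, (W u v * φ v - d u * (d v * φ v) / D) / r u := by
      simp only [Matrix.mulVec, dotProduct, hM, sub_mul, sum_sub_distrib, ite_mul, zero_mul,
        sum_ite_eq, mem_univ, if_true]
      congr 1
      refine sum_congr rfl fun v _ => ?_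
      have := (hr0 v).ne'
      have := (hr0 u).ne'
      field_simp
    rw [h1, ← sum_div, sum_sub_distrib, ← sum_div, ← mul_sum, ← hrr u]
    have := (hr0 u).ne'
    field_simp
  have hpsd : M.PosSemidef := by
    rw [hMh.posSemidef_iff_eigenvalues_nonneg]
    intro i
    by_contra hneg
    simp only [Pi.zero_apply, not_le] at hneg
    set μ := hMh.eigenvalues i
    set x : n → ℝ := ⇑(hMh.eigenvectorBasis i) with hx
    have hMx : M.mulVec x = μ • x := hMh.mulVec_eigenvectorBasis i
    have hx0 : x ≠ 0 := by
      intro h0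
      apply hMh.eigenvectorBasis.orthonormal.ne_zero i
      ext u
      exact congrFun h0 u
    set φ : n → ℝ := fun u => x u / r u with hφ
    have hxφ : x = fun v => r v * φ v := by
      funext v
      simp only [hφ]
      rw [mul_div_cancel₀ _ (hr0 v).ne']
    have heq : ∀ u, ∑ v, W u v * φ v - d u * (∑ v, d v * φ v) / D =
        (θ - μ) * (d u * φ u) := by
      intro u
      have h := hMv φ u
      rw [← hxφ, hMx, Pi.smul_apply, smul_eq_mul, congrFun hxφ u] at h
      rw [← hrr u] at h ⊢
      linarith
    have hDpos : 0 < D := sum_pos (fun u _ => hd u) ⟨i, mem_univ i⟩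
    have hmean : ∑ u, d u * φ u = 0 := by
      have h := sum_congr (rfl : (univ : Finset n) = univ) fun u _ => heq u
      rw [← mul_sum, sum_sub_distrib, sum_comm, ← sum_div, ← sum_mul, ← hD,
        mul_div_cancel_left₀ _ hDpos.ne'] at h
      have h2 : ∑ v, ∑ u, W u v * φ v = ∑ v, d v * φ v := by
        refine sum_congr rfl fun v _ => ?_
        rw [← sum_mul, ← hrow v]
        simp only [hW v]
      rw [h2, sub_self] at h
      exact (mul_eq_zero.1 h.symm).resolve_left (by linarith)
    have := H (θ - μ) φ (fun u => by rw [← heq u, hmean]; simp) hmean (by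
      intro h0
      apply hx0
      rw [hxφ, h0]
      ext v
      simp)
    linarith
  have hfin := hpsd.dotProduct_mulVec_nonneg (fun v => r v * ψ v)
  have hexp : star (fun v => r v * ψ v) ⬝ᵥ M.mulVec (fun v => r v * ψ v) =
      θ * ∑ u, d u * ψ u ^ 2 - ∑ u, ψ u * ∑ v, W u v * ψ v := by
    rw [mul_sum, ← sum_sub_distrib]
    simp only [dotProduct, Pi.star_apply, star_trivial]
    refine sum_congr rfl fun u _ => ?_
    have h := hMv ψ u
    rw [hψ] at h
    calc r u * ψ u * M.mulVec (fun v => r v * ψ v) u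
        = ψ u * (r u * M.mulVec (fun v => r v * ψ v) u) := by ring
      _ = _ := by rw [h]; ring
  rw [hexp] at hfin
  linarith

/-- If all roots of the characteristic polynomial of `A`, apart from one copy of `1`, are at most
`lam`, and `A` fixes the constants, then every nonconstant eigenvector has eigenvalue at most
`lam`: a nonconstant eigenvector for `1` would make the multiplicity of `1` at least two. -/
theorem eigenvalue_le_of_roots_erase_one_le (A : Matrix n n ℝ) {lam : ℝ}
    (hA : ∀ μ ∈ A.charpoly.roots.erase 1, μ ≤ lam) (h1 : A.mulVec (fun _ => 1) = fun _ => 1)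
    {γ : ℝ} {φ : n → ℝ} (hφ : A.mulVec φ = γ • φ) (hc : ∀ c : ℝ, φ ≠ fun _ => c) :
    γ ≤ lam := by
  have hcount : Module.finrank ℝ (Module.End.eigenspace (Matrix.toLin' A) γ) ≤ A.charpoly.roots.count γ := by
    rw [Polynomial.count_roots, ← Matrix.charpoly_toLin']
    exact LinearMap.finrank_eigenspace_le _ _
  have hφm : φ ∈ Module.End.eigenspace (Matrix.toLin' A) γ := by
    rw [Module.End.mem_eigenspace_iff, Matrix.toLin'_apply, hφ]
  have hφ0 : φ ≠ 0 := fun h => hc 0 h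
  refine hA γ ?_
  rw [← Multiset.one_le_count_iff_mem]
  by_cases hγ : γ = 1
  · subst hγ
    have h1m : (fun _ => 1 : n → ℝ) ∈ Module.End.eigenspace (Matrix.toLin' A) (1 : ℝ) := by
      rw [Module.End.mem_eigenspace_iff, Matrix.toLin'_apply, h1, one_smul]
    have hne : (fun _ => 1 : n → ℝ) ≠ 0 := by
      intro h0
      apply hφ0
      funext u
      exact absurd (congrFun h0 u) one_ne_zero
    have hli : LinearIndependent ℝ
        ![(⟨_, h1m⟩ : Module.End.eigenspace (Matrix.toLin' A) (1 : ℝ)), ⟨φ, hφm⟩] := by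
      rw [LinearIndependent.pair_iff' (by simpa [Subtype.ext_iff] using hne)]
      intro a ha
      apply hc a
      rw [Subtype.ext_iff] at ha
      rw [← show a • (fun _ => 1 : n → ℝ) = φ from ha]
      ext u
      simp
    have h2 := hli.fintype_card_le_finrank
    rw [Fintype.card_fin] at h2
    rw [Multiset.count_erase_self]
    omega
  · rw [Multiset.count_erase_of_ne hγ]
    refine le_trans ?_ hcount
    rw [Nat.one_le_iff_ne_zero, ← Nat.pos_iff_ne_zero, Module.finrank_pos_iff]
    exact ⟨⟨φ, hφm⟩, 0, by simpa [Subtype.ext_iff] using hφ0⟩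

end Spectral

/-! ### Weighted sums over links -/

section LinkSums

variable {V : Type*} [DecidableEq V]

/-- The vertices of the link of `S` in the complex with facets `F`. -/
def linkVertices (F : Finset (Finset V)) (S : Finset V) : Finset V :=
  {t ∈ F | S ⊆ t}.biUnion fun t => t \ S

/-- The unnormalized expectation of `G T` over the top-level faces `T = t \ S` of the link of `S`,
where the facet `t` has weight `p t`. -/
def linkSum (F : Finset (Finset V)) (p : Finset V → ℝ) (S : Finset V) (G : Finset V → ℝ) : ℝ :=
  ∑ t ∈ F with S ⊆ t, p t * G (t \ S)

/-- The total weight of the link of `S`. -/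
def linkWeight (F : Finset (Finset V)) (p : Finset V → ℝ) (S : Finset V) : ℝ :=
  linkSum F p S fun _ => 1

/-- The unnormalized expectation of the sum of `φ` over the vertices of a random top-level face of
the link of `S`. -/
def vertexSum (F : Finset (Finset V)) (p : Finset V → ℝ) (S : Finset V) (φ : V → ℝ) : ℝ :=
  linkSum F p S fun T => ∑ u ∈ T, φ u

/-- The unnormalized expectation of the sum of `h` over the ordered pairs of distinct vertices of a
random top-level face of the link of `S`. -/
def pairSum (F : Finset (Finset V)) (p : Finset V → ℝ) (S : Finset V) (h : V → V → ℝ) : ℝ :=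
  linkSum F p S fun T => ∑ u ∈ T, ∑ v ∈ T.erase u, h u v

variable {F : Finset (Finset V)} {p : Finset V → ℝ} {S : Finset V} {k : ℕ}

theorem mem_linkVertices {u : V} :
    u ∈ linkVertices F S ↔ u ∉ S ∧ ∃ t ∈ F, insert u S ⊆ t := by
  simp only [linkVertices, mem_biUnion, mem_filter, mem_sdiff, insert_subset_iff]
  tauto

theorem linkSum_congr {G G' : Finset V → ℝ}
    (h : ∀ t ∈ F, S ⊆ t → G (t \ S) = G' (t \ S)) : linkSum F p S G = linkSum F p S G' :=
  sum_congr rfl fun t ht => by rw [h t (mem_filter.1 ht).1 (mem_filter.1 ht).2]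

theorem linkSum_le (hp : ∀ t ∈ F, 0 < p t) {G G' : Finset V → ℝ}
    (h : ∀ t ∈ F, S ⊆ t → G (t \ S) ≤ G' (t \ S)) : linkSum F p S G ≤ linkSum F p S G' :=
  sum_le_sum fun t ht => mul_le_mul_of_nonneg_left (h t (mem_filter.1 ht).1 (mem_filter.1 ht).2)
    (hp t (mem_filter.1 ht).1).le

theorem linkSum_add (G G' : Finset V → ℝ) :
    linkSum F p S (fun T => G T + G' T) = linkSum F p S G + linkSum F p S G' := by
  simp only [linkSum, mul_add, sum_add_distrib]

theorem linkSum_const_mul (c : ℝ) (G : Finset V → ℝ) :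
    linkSum F p S (fun T => c * G T) = c * linkSum F p S G := by
  simp only [linkSum, mul_sum, mul_left_comm]

theorem linkWeight_pos (hp : ∀ t ∈ F, 0 < p t) (hS : ∃ t ∈ F, S ⊆ t) :
    0 < linkWeight F p S := by
  obtain ⟨t, ht, hSt⟩ := hS
  simp only [linkWeight, linkSum, mul_one]
  exact sum_pos (fun t ht => hp t (mem_filter.1 ht).1) ⟨t, mem_filter.2 ⟨ht, hSt⟩⟩

theorem linkWeight_insert_pos (hp : ∀ t ∈ F, 0 < p t) {u : V} (hu : u ∈ linkVertices F S) :
    0 < linkWeight F p (insert u S) :=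
  linkWeight_pos hp (mem_linkVertices.1 hu).2

/-- Fubini: choosing a vertex of the link of `S` and then a facet through it is choosing a facet
and then one of its vertices. -/
theorem sum_linkSum_insert (G : V → Finset V → ℝ) :
    ∑ w ∈ linkVertices F S, linkSum F p (insert w S) (G w) =
      linkSum F p S fun T => ∑ w ∈ T, G w (T.erase w) := by
  simp only [linkSum, mul_sum]
  rw [sum_comm' (t' := {t ∈ F | S ⊆ t}) (s' := fun t => t \ S)]
  · refine sum_congr rfl fun t _ => sum_congr rfl fun w _ => ?_
    rw [sdiff_insert]
  · intro w t
    simp only [mem_linkVertices, mem_filter, mem_sdiff, insert_subset_iff]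
    constructor
    · rintro ⟨⟨h1, -⟩, h2, h3, h4⟩
      exact ⟨⟨h3, h1⟩, h2, h4⟩
    · rintro ⟨⟨h3, h1⟩, h2, h4⟩
      exact ⟨⟨h1, t, h2, h3, h4⟩, h2, h3, h4⟩

theorem sum_linkWeight_insert (φ : V → ℝ) :
    ∑ w ∈ linkVertices F S, linkWeight F p (insert w S) * φ w = vertexSum F p S φ := by
  rw [vertexSum, ← sum_linkSum_insert (fun w _ => φ w)]
  refine sum_congr rfl fun w _ => ?_
  simp [linkWeight, linkSum, sum_mul]

theorem sum_vertexSum_insert (h : V → V → ℝ) :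
    ∑ w ∈ linkVertices F S, vertexSum F p (insert w S) (h w) = pairSum F p S h := by
  simp only [vertexSum]
  rw [sum_linkSum_insert (fun w T => ∑ u ∈ T, h w u)]
  rfl

theorem sum_sum_erase (T : Finset V) (φ : V → ℝ) :
    ∑ w ∈ T, ∑ u ∈ T.erase w, φ u = ((T.card : ℝ) - 1) * ∑ u ∈ T, φ u := by
  have h : ∀ w ∈ T, ∑ u ∈ T.erase w, φ u = ∑ u ∈ T, φ u - φ w := fun w hw => by
    rw [← add_sum_erase T φ hw]; ring
  rw [sum_congr rfl h, sum_sub_distrib, sum_const, nsmul_eq_mul]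
  ring

theorem card_sdiff_facet (hF : ∀ t ∈ F, t.card = k) {t : Finset V} (ht : t ∈ F) (hS : S ⊆ t) :
    ((t \ S).card : ℝ) = k - S.card := by
  rw [card_sdiff_of_subset hS, Nat.cast_sub (card_le_card hS), hF t ht]

theorem pairSum_const_right (hF : ∀ t ∈ F, t.card = k) (φ : V → ℝ) :
    pairSum F p S (fun u _ => φ u) = ((k : ℝ) - S.card - 1) * vertexSum F p S φ := by
  rw [pairSum, vertexSum, ← linkSum_const_mul]
  refine linkSum_congr fun t ht hS => ?_
  rw [mul_sum]
  refine sum_congr rfl fun u hu => ?_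
  rw [sum_const, nsmul_eq_mul, cast_card_erase_of_mem hu, card_sdiff_facet hF ht hS]

theorem pairSum_const_left (hF : ∀ t ∈ F, t.card = k) (φ : V → ℝ) :
    pairSum F p S (fun _ v => φ v) = ((k : ℝ) - S.card - 1) * vertexSum F p S φ := by
  rw [pairSum, vertexSum, ← linkSum_const_mul]
  refine linkSum_congr fun t ht hS => ?_
  rw [sum_sum_erase, card_sdiff_facet hF ht hS]

theorem vertexSum_const (hF : ∀ t ∈ F, t.card = k) (c : ℝ) :
    vertexSum F p S (fun _ => c) = ((k : ℝ) - S.card) * c * linkWeight F p S := by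
  rw [linkWeight, vertexSum, ← linkSum_const_mul]
  refine linkSum_congr fun t ht hS => ?_
  rw [sum_const, nsmul_eq_mul, card_sdiff_facet hF ht hS, mul_one]

/-- Averaging over the links of the vertices recovers vertex sums. -/
theorem sum_vertexSum_insert_const (hF : ∀ t ∈ F, t.card = k) (φ : V → ℝ) :
    ∑ w ∈ linkVertices F S, vertexSum F p (insert w S) φ =
      ((k : ℝ) - S.card - 1) * vertexSum F p S φ := by
  rw [sum_vertexSum_insert (fun _ => φ), pairSum_const_left hF]

/-- Averaging over the links of the vertices recovers pair sums. -/
theorem sum_pairSum_insert (hF : ∀ t ∈ F, t.card = k) (h : V → V → ℝ) :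
    ∑ w ∈ linkVertices F S, pairSum F p (insert w S) h =
      ((k : ℝ) - S.card - 2) * pairSum F p S h := by
  simp only [pairSum]
  rw [sum_linkSum_insert (fun _ T => ∑ u ∈ T, ∑ v ∈ T.erase u, h u v), ← linkSum_const_mul]
  refine linkSum_congr fun t ht hS => ?_
  rw [sum_comm' (t' := t \ S) (s' := fun u => (t \ S).erase u)]
  · rw [mul_sum]
    refine sum_congr rfl fun u hu => ?_
    have : ∀ w ∈ (t \ S).erase u, ∑ v ∈ ((t \ S).erase w).erase u, h u v =
        ∑ v ∈ ((t \ S).erase u).erase w, h u v := fun w _ => by rw [erase_right_comm]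
    rw [sum_congr rfl this, sum_sum_erase, cast_card_erase_of_mem hu, card_sdiff_facet hF ht hS]
    ring
  · intro w u
    simp only [mem_erase]
    tauto

theorem vertexSum_add (φ ψ : V → ℝ) :
    vertexSum F p S (fun u => φ u + ψ u) = vertexSum F p S φ + vertexSum F p S ψ := by
  simp only [vertexSum, sum_add_distrib, linkSum_add]

theorem vertexSum_const_mul (c : ℝ) (φ : V → ℝ) :
    vertexSum F p S (fun u => c * φ u) = c * vertexSum F p S φ := by
  simp only [vertexSum, ← mul_sum, linkSum_const_mul]

theorem pairSum_add (g h : V → V → ℝ) :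
    pairSum F p S (fun u v => g u v + h u v) = pairSum F p S g + pairSum F p S h := by
  simp only [pairSum, sum_add_distrib, linkSum_add]

theorem pairSum_const_mul (c : ℝ) (h : V → V → ℝ) :
    pairSum F p S (fun u v => c * h u v) = c * pairSum F p S h := by
  simp only [pairSum, ← mul_sum, linkSum_const_mul]

theorem vertexSum_sq_nonneg (hp : ∀ t ∈ F, 0 < p t) (φ : V → ℝ) :
    0 ≤ vertexSum F p S fun u => φ u ^ 2 :=
  sum_nonneg fun t ht => mul_nonneg (hp t (mem_filter.1 ht).1).le
    (sum_nonneg fun _ _ => sq_nonneg _)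

/-- The quadratic form of the graph of the link of `S` at a function shifted by a constant. -/
theorem pairSum_shift (hF : ∀ t ∈ F, t.card = k) (φ : V → ℝ) (c : ℝ) :
    pairSum F p S (fun u v => (φ u + c) * (φ v + c)) =
      pairSum F p S (fun u v => φ u * φ v) + ((k : ℝ) - S.card - 1) *
        (2 * c * vertexSum F p S φ + c ^ 2 * ((k : ℝ) - S.card) * linkWeight F p S) := by
  have h : (fun u v => (φ u + c) * (φ v + c)) = fun u v =>
      φ u * φ v + (c * φ u + (c * φ v + c ^ 2)) := by
    funext u v; ring
  rw [h, pairSum_add, pairSum_add, pairSum_add, pairSum_const_mul, pairSum_const_mul,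
    pairSum_const_right hF, pairSum_const_left hF, pairSum_const_right hF (fun _ => c ^ 2),
    vertexSum_const hF]
  ring

theorem vertexSum_sq_shift (hF : ∀ t ∈ F, t.card = k) (φ : V → ℝ) (c : ℝ) :
    vertexSum F p S (fun u => (φ u + c) ^ 2) =
      vertexSum F p S (fun u => φ u ^ 2) +
        (2 * c * vertexSum F p S φ + c ^ 2 * ((k : ℝ) - S.card) * linkWeight F p S) := by
  have h : (fun u => (φ u + c) ^ 2) = fun u => φ u ^ 2 + (2 * c * φ u + c ^ 2) := by
    funext u; ring
  rw [h, vertexSum_add, vertexSum_add, vertexSum_const_mul, vertexSum_const hF]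
  ring

end LinkSums

/-! ### Spectral gaps of links: trickling down and tilting -/

section Gap

variable {V : Type*} [DecidableEq V]

/-- The graph underlying the link of `S`, in the complex with facets `F` of size `k` and facet
weights `p`, has second largest eigenvalue at most `θ`. This is expressed by the Rayleigh quotient
on functions of mean zero, with the normalizations of the two sides cleared. -/
def HasGap (F : Finset (Finset V)) (p : Finset V → ℝ) (k : ℕ) (S : Finset V) (θ : ℝ) : Prop :=
  ∀ φ : V → ℝ, vertexSum F p S φ = 0 →
    pairSum F p S (fun u v => φ u * φ v) ≤
      θ * (((k : ℝ) - S.card - 1) * vertexSum F p S fun u => φ u ^ 2)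

/-- The graph underlying the link of `S` is connected: a function on its vertices which is constant
along edges is constant. -/
def LinkConnected (F : Finset (Finset V)) (S : Finset V) : Prop :=
  ∀ φ : V → ℝ, (∀ t ∈ F, S ⊆ t → ∀ u ∈ t \ S, ∀ v ∈ t \ S, φ u = φ v) →
    ∀ u ∈ linkVertices F S, ∀ v ∈ linkVertices F S, φ u = φ v

variable {F : Finset (Finset V)} {p : Finset V → ℝ} {S : Finset V} {k : ℕ}

theorem HasGap.mono (hp : ∀ t ∈ F, 0 < p t) (hS : S.card + 1 ≤ k) {θ θ' : ℝ} (h : θ ≤ θ')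
    (H : HasGap F p k S θ) : HasGap F p k S θ' := by
  intro φ hφ
  refine (H φ hφ).trans (mul_le_mul_of_nonneg_right h (mul_nonneg ?_ (vertexSum_sq_nonneg hp φ)))
  have : ((S.card + 1 : ℕ) : ℝ) ≤ k := Nat.cast_le.2 hS
  push_cast at this
  linarith

theorem linkWeight_eq_zero (h : ¬∃ t ∈ F, S ⊆ t) : linkWeight F p S = 0 := by
  refine sum_eq_zero fun t ht => ?_
  exact absurd ⟨t, (mem_filter.1 ht).1, (mem_filter.1 ht).2⟩ h

/-- The rows of the weighted adjacency matrix of the graph underlying the link of `S`. -/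
theorem sum_adj_mul {u : V} (hu : u ∈ linkVertices F S) (φ : V → ℝ) :
    ∑ v ∈ linkVertices F S, (if u = v then 0 else linkWeight F p (insert v (insert u S))) * φ v =
      vertexSum F p (insert u S) φ := by
  rw [← sum_linkWeight_insert]
  have hsub : linkVertices F (insert u S) ⊆ linkVertices F S := by
    intro v hv
    rw [mem_linkVertices] at hv ⊢
    obtain ⟨h1, t, ht, h2⟩ := hv
    exact ⟨fun h => h1 (mem_insert_of_mem h), t, ht,
      (insert_subset_insert v (subset_insert u S)).trans h2⟩
  rw [← sum_subset hsub]
  · refine sum_congr rfl fun v hv => ?_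
    have : u ≠ v := fun h => (mem_linkVertices.1 hv).1 (h ▸ mem_insert_self u S)
    rw [if_neg this]
  · intro v hv hv'
    split_ifs with h
    · rw [zero_mul]
    · rw [linkWeight_eq_zero, zero_mul]
      intro hex
      refine hv' (mem_linkVertices.2 ⟨?_, hex⟩)
      rw [mem_insert]
      rintro (rfl | h')
      · exact h rfl
      · exact (mem_linkVertices.1 hv).1 h'

/-- A bound on the eigenvalues with a nonzero eigenfunction of mean zero gives a spectral gap. -/
theorem hasGap_of_eigenvalue_le (hF : ∀ t ∈ F, t.card = k) (hp : ∀ t ∈ F, 0 < p t)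
    (hS : S.card + 2 ≤ k) {θ : ℝ} (hθ : 0 ≤ θ)
    (H : ∀ (γ : ℝ) (φ : V → ℝ), (∀ u ∈ linkVertices F S, vertexSum F p (insert u S) φ =
        γ * (((k : ℝ) - S.card - 1) * linkWeight F p (insert u S) * φ u)) →
      vertexSum F p S φ = 0 → (∃ u ∈ linkVertices F S, φ u ≠ 0) → γ ≤ θ) :
    HasGap F p k S θ := by
  have hr : 0 < (k : ℝ) - S.card - 1 := by
    have : ((S.card + 2 : ℕ) : ℝ) ≤ k := Nat.cast_le.2 hS
    push_cast at this
    linarith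
  set U := linkVertices F S with hU
  have hrow : ∀ (φ : V → ℝ) (u : U), ∑ v : U,
      (if (u : V) = v then 0 else linkWeight F p (insert (v : V) (insert (u : V) S))) * φ v =
        vertexSum F p (insert (u : V) S) φ := by
    intro φ u
    rw [← sum_adj_mul u.2,
      ← sum_coe_sort U (fun v => (if (u : V) = v then 0 else
        linkWeight F p (insert v (insert (u : V) S))) * φ v)]
  have hdeg : ∀ φ : V → ℝ, ∑ u : U,
      (((k : ℝ) - S.card - 1) * linkWeight F p (insert (u : V) S)) * φ u =
        ((k : ℝ) - S.card - 1) * vertexSum F p S φ := by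
    intro φ
    rw [← sum_linkWeight_insert, mul_sum, ← sum_coe_sort (linkVertices F S)]
    exact sum_congr rfl fun u _ => by ring
  intro φ hφ
  have key := sum_mul_mulVec_le_of_eigenvalue_le
    (fun u v : U => if (u : V) = v then 0 else
      linkWeight F p (insert (v : V) (insert (u : V) S)))
    (fun u v => by simp only [eq_comm (a := (u : V)), insert_comm (u : V)])
    (fun u => ((k : ℝ) - S.card - 1) * linkWeight F p (insert (u : V) S))
    (fun u => mul_pos hr (linkWeight_insert_pos hp u.2))
    (fun u => by
      have h := hrow (fun _ => 1) u
      simp only [mul_one] at h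
      rw [h, vertexSum_const hF, card_insert_of_notMem (mem_linkVertices.1 u.2).1]
      push_cast
      ring) hθ
    (by
      intro γ χ h1 h2 h3
      -- extend the eigenfunction by zero
      set ξ : V → ℝ := fun v => if h : v ∈ U then χ ⟨v, h⟩ else 0 with hξ
      have hξχ : ∀ u : U, χ u = ξ u := fun u => by simp [hξ]
      simp only [hξχ] at h1 h2
      refine H γ ξ (fun u hu => ?_) ?_ ?_
      · rw [← hrow ξ ⟨u, hu⟩]
        exact h1 ⟨u, hu⟩
      · rw [hdeg] at h2
        exact (mul_eq_zero.1 h2).resolve_left hr.ne'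
      · obtain ⟨u, hu⟩ := Function.ne_iff.1 h3
        exact ⟨u, u.2, by rwa [← hξχ]⟩)
    (fun u => φ u)
    (by rw [hdeg φ, hφ, mul_zero])
  simp only [hrow] at key
  rw [hdeg (fun u => φ u ^ 2), sum_coe_sort U (fun u => φ u * vertexSum F p (insert u S) φ)] at key
  convert key using 1
  rw [← sum_vertexSum_insert]
  exact sum_congr rfl fun u _ => vertexSum_const_mul _ _

/-- The spectral gap for functions whose mean need not vanish. -/
theorem HasGap.pairSum_le (hF : ∀ t ∈ F, t.card = k) (hp : ∀ t ∈ F, 0 < p t)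
    (hS : S.card + 1 ≤ k) (hSF : ∃ t ∈ F, S ⊆ t) {θ : ℝ} (H : HasGap F p k S θ) (φ : V → ℝ) :
    pairSum F p S (fun u v => φ u * φ v) ≤ ((k : ℝ) - S.card - 1) *
      ((1 - θ) * (vertexSum F p S φ ^ 2 / (((k : ℝ) - S.card) * linkWeight F p S)) +
        θ * vertexSum F p S fun u => φ u ^ 2) := by
  have hr : 0 < (k : ℝ) - S.card := by
    have : ((S.card + 1 : ℕ) : ℝ) ≤ k := Nat.cast_le.2 hS
    push_cast at this
    linarith
  have hw := linkWeight_pos hp hSF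
  set D := ((k : ℝ) - S.card) * linkWeight F p S with hD
  have hD0 : 0 < D := mul_pos hr hw
  set c := -(vertexSum F p S φ / D) with hc
  have hcD : c * D = -vertexSum F p S φ := by
    rw [hc, neg_mul, div_mul_cancel₀ _ hD0.ne']
  have h := H (fun u => φ u + c) (by
    rw [vertexSum_add, vertexSum_const hF]
    linarith)
  rw [pairSum_shift hF, vertexSum_sq_shift hF, mul_assoc (c ^ 2), ← hD] at h
  have h1 : c ^ 2 * D = vertexSum F p S φ ^ 2 / D := by
    rw [hc]; field_simp
  have h2 : 2 * c * vertexSum F p S φ = -2 * (vertexSum F p S φ ^ 2 / D) := by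
    rw [hc]; ring
  rw [h1, h2] at h
  linarith

/-- Oppenheim's trickling-down theorem: a spectral gap in the links of the vertices, together with
connectedness, gives a spectral gap. An eigenvalue `γ` satisfies `γ ≤ (1 - θ) γ ^ 2 + θ`, so it is
at most `θ / (1 - θ)` or at least `1`; connectedness excludes the latter. -/
theorem hasGap_of_hasGap_insert (hF : ∀ t ∈ F, t.card = k) (hp : ∀ t ∈ F, 0 < p t)
    (hS : S.card + 3 ≤ k) {θ : ℝ} (hθ : 0 ≤ θ) (hθ1 : θ < 1)
    (H : ∀ w ∈ linkVertices F S, HasGap F p k (insert w S) θ) (hconn : LinkConnected F S) :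
    HasGap F p k S (θ / (1 - θ)) := by
  have hS' : ((S.card + 3 : ℕ) : ℝ) ≤ k := Nat.cast_le.2 hS
  push_cast at hS'
  refine hasGap_of_eigenvalue_le hF hp (by omega) (div_nonneg hθ (by linarith)) ?_
  intro γ φ heig hmean hne
  set Q := vertexSum F p S fun u => φ u ^ 2 with hQ
  have hQsum : ∑ w ∈ linkVertices F S, linkWeight F p (insert w S) * φ w ^ 2 = Q :=
    sum_linkWeight_insert _
  have hQpos : 0 < Q := by
    obtain ⟨u, hu, hu0⟩ := hne
    rw [← hQsum]
    refine sum_pos' (fun w hw => mul_nonneg (linkWeight_insert_pos hp hw).le (sq_nonneg _))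
      ⟨u, hu, mul_pos (linkWeight_insert_pos hp hu) (by positivity)⟩
  have hpair : pairSum F p S (fun u v => φ u * φ v) = γ * (((k : ℝ) - S.card - 1) * Q) := by
    rw [← sum_vertexSum_insert, ← hQsum, mul_sum, mul_sum]
    refine sum_congr rfl fun w hw => ?_
    rw [vertexSum_const_mul, heig w hw]
    ring
  have hquad : ((k : ℝ) - S.card - 2) * pairSum F p S (fun u v => φ u * φ v) ≤
      ((k : ℝ) - S.card - 2) *
        (((1 - θ) * γ ^ 2 + θ) * (((k : ℝ) - S.card - 1) * Q)) := by
    rw [← sum_pairSum_insert hF]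
    calc ∑ w ∈ linkVertices F S, pairSum F p (insert w S) (fun u v => φ u * φ v)
        ≤ ∑ w ∈ linkVertices F S, ((k : ℝ) - S.card - 2) *
            ((1 - θ) * (γ ^ 2 * (((k : ℝ) - S.card - 1) *
              (linkWeight F p (insert w S) * φ w ^ 2))) +
              θ * vertexSum F p (insert w S) fun u => φ u ^ 2) := by
          refine sum_le_sum fun w hw => ?_
          have hcard : ((insert w S).card : ℝ) = S.card + 1 := by
            rw [card_insert_of_notMem (mem_linkVertices.1 hw).1]; push_cast; ring
          have h := (H w hw).pairSum_le hF hp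
            (by rw [card_insert_of_notMem (mem_linkVertices.1 hw).1]; omega)
            (mem_linkVertices.1 hw).2 φ
          have hw0 := linkWeight_insert_pos hp hw
          have hne1 : (k : ℝ) - (S.card + 1) ≠ 0 := by linarith
          rw [heig w hw, hcard] at h
          refine h.trans_eq ?_
          field_simp
          ring
      _ = _ := by
          rw [← mul_sum, sum_add_distrib, ← mul_sum, ← mul_sum, ← mul_sum, ← mul_sum, hQsum,
            sum_vertexSum_insert_const hF]
          ring
  have hγ : γ ≤ (1 - θ) * γ ^ 2 + θ := by
    have h := le_of_mul_le_mul_left hquad (by linarith)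
    rw [hpair] at h
    exact le_of_mul_le_mul_right h (mul_pos (by linarith) hQpos)
  rcases lt_or_ge γ 1 with hγ1 | hγ1
  · rw [le_div_iff₀ (by linarith)]
    nlinarith
  · exfalso
    have hdir : pairSum F p S (fun u v => (φ u - φ v) ^ 2) ≤ 0 := by
      have h : (fun u v => (φ u - φ v) ^ 2) = fun u v =>
          φ u ^ 2 + (φ v ^ 2 + (-2) * (φ u * φ v)) := by
        funext u v; ring
      rw [h, pairSum_add, pairSum_add, pairSum_const_mul, hpair,
        pairSum_const_right hF (fun u => φ u ^ 2), pairSum_const_left hF (fun u => φ u ^ 2)]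
      have : 0 ≤ (γ - 1) * (((k : ℝ) - S.card - 1) * Q) :=
        mul_nonneg (by linarith) (mul_nonneg (by linarith) hQpos.le)
      linarith
    have hconst := hconn φ (by
      intro t ht hSt u hu v hv
      by_contra hne
      have hpos : 0 < pairSum F p S (fun u v => (φ u - φ v) ^ 2) := by
        refine sum_pos' (fun t ht => mul_nonneg (hp t (mem_filter.1 ht).1).le
          (sum_nonneg fun _ _ => sum_nonneg fun _ _ => sq_nonneg _))
          ⟨t, mem_filter.2 ⟨ht, hSt⟩, mul_pos (hp t ht) ?_⟩
        refine sum_pos' (fun _ _ => sum_nonneg fun _ _ => sq_nonneg _) ⟨u, hu, ?_⟩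
        refine sum_pos' (fun _ _ => sq_nonneg _) ⟨v, mem_erase.2 ⟨?_, hv⟩, ?_⟩
        · rintro rfl
          exact hne rfl
        · exact sq_pos_of_ne_zero (sub_ne_zero.2 hne)
      exact absurd hdir (not_le.2 hpos))
    obtain ⟨u, hu, hu0⟩ := hne
    rw [← sum_linkWeight_insert, sum_congr rfl
      (g := fun w => linkWeight F p (insert w S) * φ u)
      (fun w hw => by rw [hconst w hw u hu]), ← sum_mul] at hmean
    exact mul_ne_zero (sum_pos (fun w hw => linkWeight_insert_pos hp hw) ⟨u, hu⟩).ne' hu0 hmean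

/-- The reweighting of the facets by `exp (s * ∑ f)`. -/
noncomputable def expTilt (p : Finset V → ℝ) (s : ℝ) (f : V → ℝ) (t : Finset V) : ℝ :=
  p t * Real.exp (s * ∑ v ∈ t, f v)

omit [DecidableEq V] in
theorem expTilt_pos (hp : ∀ t ∈ F, 0 < p t) (s : ℝ) (f : V → ℝ) :
    ∀ t ∈ F, 0 < expTilt p s f t :=
  fun t ht => mul_pos (hp t ht) (Real.exp_pos _)

/-- On the link of `S`, the tilt factors into a constant and the tilt of the link. -/
theorem linkSum_expTilt (s : ℝ) (f : V → ℝ) (G : Finset V → ℝ) :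
    linkSum F (expTilt p s f) S G = Real.exp (s * ∑ v ∈ S, f v) *
      linkSum F p S fun T => Real.exp (s * ∑ v ∈ T, f v) * G T := by
  rw [linkSum, linkSum, mul_sum]
  refine sum_congr rfl fun t ht => ?_
  rw [expTilt, ← sum_sdiff (mem_filter.1 ht).2, mul_add, Real.exp_add]
  ring

/-- A graph in which `f` oscillates by at most one loses at most a factor `exp s` in its second
eigenvalue when the weight of each edge `uv` is multiplied by `exp (s * (f u + f v))`. -/
theorem HasGap.tilt (hF : ∀ t ∈ F, t.card = k) (hp : ∀ t ∈ F, 0 < p t)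
    (hS : S.card + 2 = k) (hSF : ∃ t ∈ F, S ⊆ t) {lam s : ℝ} (hlam : 0 ≤ lam) (hs : 0 ≤ s)
    (hls : lam * Real.exp s ≤ 1) {f : V → ℝ}
    (hf : ∀ u ∈ linkVertices F S, ∀ v ∈ linkVertices F S, f u - f v ≤ 1)
    (H : HasGap F p k S lam) : HasGap F (expTilt p s f) k S (lam * Real.exp s) := by
  have hr : (k : ℝ) - S.card = 2 := by rw [← hS]; push_cast; ring
  set g : V → ℝ := fun u => Real.exp (s * f u) with hg
  set C := Real.exp (s * ∑ v ∈ S, f v) with hC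
  have hC0 : 0 < C := Real.exp_pos _
  have hp' := expTilt_pos hp s f
  have hpair : ∀ φ : V → ℝ, pairSum F (expTilt p s f) S (fun u v => φ u * φ v) =
      C * pairSum F p S (fun u v => (g u * φ u) * (g v * φ v)) := by
    intro φ
    rw [pairSum, linkSum_expTilt, pairSum]
    congr 1
    refine linkSum_congr fun t ht hSt => ?_
    have hc : (t \ S).card = 2 := by rw [card_sdiff_of_subset hSt, hF t ht]; omega
    obtain ⟨a, b, hab, h⟩ := card_eq_two.1 hc
    have he1 : ({a, b} : Finset V).erase a = {b} := by
      ext x; simp only [mem_erase, mem_insert, mem_singleton]; grind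
    have he2 : ({a, b} : Finset V).erase b = {a} := by
      ext x; simp only [mem_erase, mem_insert, mem_singleton]; grind
    rw [h, sum_pair hab, sum_pair hab, sum_pair hab, he1, he2]
    simp only [sum_singleton, hg, mul_add, Real.exp_add]
    ring
  have hvert : ∀ φ : V → ℝ, C * vertexSum F p S (fun u => (g u * φ u) ^ 2) ≤
      Real.exp s * vertexSum F (expTilt p s f) S (fun u => φ u ^ 2) := by
    intro φ
    rw [vertexSum, vertexSum, linkSum_expTilt, ← hC, mul_left_comm (Real.exp s)]
    refine mul_le_mul_of_nonneg_left ?_ hC0.le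
    rw [← linkSum_const_mul]
    refine linkSum_le hp fun t ht hSt => ?_
    have hc : (t \ S).card = 2 := by rw [card_sdiff_of_subset hSt, hF t ht]; omega
    have hmem : ∀ u ∈ t \ S, u ∈ linkVertices F S := fun u hu =>
      mem_biUnion.2 ⟨t, mem_filter.2 ⟨ht, hSt⟩, hu⟩
    obtain ⟨a, b, hab, h⟩ := card_eq_two.1 hc
    rw [h] at hmem ⊢
    have ha := hmem a (by simp)
    have hb := hmem b (by simp)
    rw [sum_pair hab, sum_pair hab, sum_pair hab]
    have key : ∀ x ∈ linkVertices F S, ∀ y ∈ linkVertices F S,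
        (g x * φ x) ^ 2 ≤ Real.exp s * (Real.exp (s * (f x + f y)) * φ x ^ 2) := by
      intro x hx y hy
      rw [mul_pow, ← mul_assoc, ← Real.exp_add, hg]
      refine mul_le_mul_of_nonneg_right ?_ (sq_nonneg _)
      simp only
      rw [← Real.exp_nat_mul]
      refine Real.exp_le_exp.2 ?_
      have := mul_le_mul_of_nonneg_left (hf x hx y hy) hs
      push_cast
      linarith
    have h1 := key a ha b hb
    have h2 := key b hb a ha
    rw [add_comm (f b)] at h2
    linarith
  intro φ hφ
  -- Shift `φ` so that `g * (φ + c)`, rather than `φ`, has mean zero. The constants are an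
  -- eigenfunction for the eigenvalue `1`, so the shift can only help.
  have hgpos : 0 < vertexSum F p S g := by
    obtain ⟨t, ht, hSt⟩ := hSF
    have hc : (t \ S).card = 2 := by rw [card_sdiff_of_subset hSt, hF t ht]; omega
    refine sum_pos' (fun t ht => mul_nonneg (hp t (mem_filter.1 ht).1).le
      (sum_nonneg fun _ _ => (Real.exp_pos _).le))
      ⟨t, mem_filter.2 ⟨ht, hSt⟩, mul_pos (hp t ht)
        (sum_pos (fun _ _ => Real.exp_pos _) (card_pos.1 (by omega)))⟩
  set c := -(vertexSum F p S (fun u => g u * φ u) / vertexSum F p S g) with hcdef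
  have h := H (fun u => g u * (φ u + c)) (by
    have h' : (fun u => g u * (φ u + c)) = fun u => g u * φ u + c * g u := by funext u; ring
    rw [h', vertexSum_add, vertexSum_const_mul, hcdef, neg_mul, div_mul_cancel₀ _ hgpos.ne']
    ring)
  have h1 := mul_le_mul_of_nonneg_left h hC0.le
  rw [← hpair (fun u => φ u + c), pairSum_shift hF, hr, hφ] at h1
  have h2 := mul_le_mul_of_nonneg_left (hvert (fun u => φ u + c)) hlam
  rw [vertexSum_sq_shift hF, hr, hφ] at h2
  have hw := (linkWeight_pos hp' hSF).le
  have h3 : 0 ≤ (1 - lam * Real.exp s) * (c ^ 2 * 2 * linkWeight F (expTilt p s f) S) :=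
    mul_nonneg (by linarith) (by positivity)
  rw [hr]
  linarith

end Gap

/-! ### The spectral gap of an expanding complex -/

section Base

variable {V : Type*} [DecidableEq V] {d k : ℕ}

namespace WeightedComplex

theorem linkVertices_empty (Y : WeightedComplex V d) :
    linkVertices Y.facets ∅ = Y.vertices := by
  simp [linkVertices, vertices]

theorem density_eq_linkWeight (Y : WeightedComplex V d) (j : ℕ) (T : Finset V) :
    Y.density j T = 1 / (d.choose j : ℝ) * linkWeight Y.facets Y.prob T := by
  simp [density, linkWeight, linkSum]

theorem mem_faces_two (Y : WeightedComplex V d) {u v : V} :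
    {v, u} ∈ Y.faces 2 ↔ v ≠ u ∧ Y.IsFace {v, u} := by
  simp only [faces, mem_biUnion, mem_powersetCard, IsFace, card_eq_two]
  constructor
  · rintro ⟨t, ht, hs, hc⟩
    refine ⟨?_, t, ht, hs⟩
    rintro rfl
    rw [← card_eq_two] at hc
    simp at hc
  · rintro ⟨hne, t, ht, hs⟩
    exact ⟨t, ht, hs, v, u, hne, rfl⟩

/-- The normalized adjacency operator in terms of weights of faces. -/
theorem adjMatrix_apply (Y : WeightedComplex V d) (hd : 2 ≤ d) (v u : Y.vertices) :
    Y.adjMatrix v u = (if (v : V) = u then 0 else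
      linkWeight Y.facets Y.prob (insert (u : V) (insert (v : V) ∅))) /
        (((d : ℝ) - 1) * linkWeight Y.facets Y.prob (insert (v : V) ∅)) := by
  have hc : (d.choose 2 : ℝ) ≠ 0 := by exact_mod_cast (Nat.choose_pos hd).ne'
  have hpair : ∀ a b : V, ({a, b} : Finset V) = insert b (insert a ∅) := fun a b => by
    rw [pair_comm]; simp
  have hite : ∀ a b : V, (if {a, b} ∈ Y.faces 2 then Y.density 2 {a, b} else 0) =
      1 / (d.choose 2 : ℝ) * if a = b then 0 else
        linkWeight Y.facets Y.prob (insert b (insert a ∅)) := by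
    intro a b
    rw [density_eq_linkWeight, ← hpair]
    by_cases hab : a = b
    · rw [if_neg (fun h => (Y.mem_faces_two.1 h).1 hab), if_pos hab, mul_zero]
    · rw [if_neg hab]
      split_ifs with h
      · rfl
      · rw [linkWeight_eq_zero (fun hf => h (Y.mem_faces_two.2 ⟨hab, hf⟩)), mul_zero]
  have hsum : ∑ w ∈ Y.vertices with {v.1, w} ∈ Y.faces 2, Y.density 2 {v.1, w} =
      1 / (d.choose 2 : ℝ) * (((d : ℝ) - 1) *
        linkWeight Y.facets Y.prob (insert (v : V) ∅)) := by
    have h := sum_adj_mul (F := Y.facets) (p := Y.prob) (S := ∅) (u := v)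
      (by rw [linkVertices_empty]; exact v.2) (fun _ => 1)
    rw [vertexSum_const Y.card_of_mem, linkVertices_empty] at h
    have h2 : ((d : ℝ) - (insert (v : V) ∅ : Finset V).card) * 1 = d - 1 := by simp
    rw [h2] at h
    rw [← h, mul_sum, sum_filter]
    refine sum_congr rfl fun w _ => ?_
    rw [mul_one]
    exact hite v w
  rw [← mul_div_mul_left _ _ (one_div_ne_zero hc), ← hite v u, ← hsum, ite_div, zero_div]
  rfl

theorem adjMatrix_mulVec (Y : WeightedComplex V d) (hd : 2 ≤ d) (φ : V → ℝ) (v : Y.vertices) :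
    Y.adjMatrix.mulVec (fun u => φ u) v =
      vertexSum Y.facets Y.prob (insert (v : V) ∅) φ /
        (((d : ℝ) - 1) * linkWeight Y.facets Y.prob (insert (v : V) ∅)) := by
  have hv : (v : V) ∈ linkVertices Y.facets ∅ := by rw [linkVertices_empty]; exact v.2
  rw [← sum_adj_mul hv, linkVertices_empty, sum_div, ← sum_coe_sort]
  simp only [Matrix.mulVec, dotProduct]
  refine sum_congr rfl fun u _ => ?_
  rw [adjMatrix_apply Y hd]
  ring

/-- The expansion hypothesis, stated without matrices: a nonconstant eigenfunction of the graph
underlying `Y` has eigenvalue at most `lam`. -/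
theorem eigenvalue_le (Y : WeightedComplex V d) (hd : 2 ≤ d) {lam : ℝ}
    (hY : Y.IsTwoSidedSpectralExpander lam) {γ : ℝ} {φ : V → ℝ}
    (hφ : ∀ u ∈ Y.vertices, vertexSum Y.facets Y.prob (insert u ∅) φ =
      γ * (((d : ℝ) - 1) * linkWeight Y.facets Y.prob (insert u ∅) * φ u))
    (hc : ∃ u ∈ Y.vertices, ∃ v ∈ Y.vertices, φ u ≠ φ v) : γ ≤ lam := by
  have hd' : (0 : ℝ) < d - 1 := by
    have : ((2 : ℕ) : ℝ) ≤ d := Nat.cast_le.2 hd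
    push_cast at this
    linarith
  have hpos : ∀ u : Y.vertices, 0 < ((d : ℝ) - 1) *
      linkWeight Y.facets Y.prob (insert (u : V) ∅) := fun u =>
    mul_pos hd' (linkWeight_insert_pos Y.prob_pos (by rw [linkVertices_empty]; exact u.2))
  refine eigenvalue_le_of_roots_erase_one_le Y.adjMatrix (fun μ hμ => (hY μ hμ).2)
    (φ := fun u => φ u) ?_ ?_ ?_
  · funext v
    rw [adjMatrix_mulVec Y hd (fun _ => 1), vertexSum_const Y.card_of_mem]
    simpa using div_self (hpos v).ne'
  · funext v
    rw [adjMatrix_mulVec Y hd, hφ v v.2, Pi.smul_apply, smul_eq_mul, mul_div_assoc,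
      mul_div_cancel_left₀ _ (hpos v).ne']
  · intro c h
    obtain ⟨u, hu, v, hv, huv⟩ := hc
    exact huv ((congrFun h ⟨u, hu⟩).trans (congrFun h ⟨v, hv⟩).symm)

variable (X : WeightedComplex V k) {S : Finset V}

/-- Sums over a link of the link of `S` are sums over a link of the complex itself. -/
theorem linkSum_link (hS : X.IsFace S) {T : Finset V} (hT : Disjoint T S) (G : Finset V → ℝ) :
    linkSum (X.link S hS).facets (X.link S hS).prob T G =
      linkSum X.facets X.prob (T ∪ S) G / linkWeight X.facets X.prob S := by
  have hw : X.density S.card S * (k.choose S.card : ℝ) = linkWeight X.facets X.prob S := by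
    rw [density_mul_choose X hS]
    simp [linkWeight, linkSum]
  simp only [linkSum, link, hw]
  rw [sum_div, filter_image, sum_image, filter_filter]
  · have hset : {t ∈ X.facets | S ⊆ t ∧ T ⊆ t \ S} = {t ∈ X.facets | T ∪ S ⊆ t} := by
      refine filter_congr fun t _ => ?_
      rw [union_subset_iff, subset_sdiff]
      tauto
    rw [hset]
    refine sum_congr rfl fun t ht => ?_
    have hSt : S ⊆ t := subset_union_right.trans (mem_filter.1 ht).2
    rw [sdiff_union_of_subset hSt, sdiff_sdiff_left, sup_eq_union, union_comm]
    ring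
  · intro t ht u hu h
    have ht' : S ⊆ t := (mem_filter.1 (mem_filter.1 (mem_coe.1 ht)).1).2
    have hu' : S ⊆ u := (mem_filter.1 (mem_filter.1 (mem_coe.1 hu)).1).2
    rw [← sdiff_union_of_subset ht', ← sdiff_union_of_subset hu']
    exact congrArg (· ∪ S) h

theorem vertices_link (hS : X.IsFace S) :
    (X.link S hS).vertices = linkVertices X.facets S := by
  simp only [vertices, link, linkVertices]
  rw [image_biUnion]

/-- The eigenvalue bound for the graph underlying the link of `S`, in terms of the complex. -/
theorem eigenvalue_link_le (hS : X.IsFace S) (hSk : S.card + 2 ≤ k) {lam : ℝ}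
    (hX : (X.link S hS).IsTwoSidedSpectralExpander lam) {γ : ℝ} {φ : V → ℝ}
    (hφ : ∀ u ∈ linkVertices X.facets S, vertexSum X.facets X.prob (insert u S) φ =
      γ * (((k : ℝ) - S.card - 1) * linkWeight X.facets X.prob (insert u S) * φ u))
    (hc : ∃ u ∈ linkVertices X.facets S, ∃ v ∈ linkVertices X.facets S, φ u ≠ φ v) :
    γ ≤ lam := by
  refine (X.link S hS).eigenvalue_le (by omega) hX (φ := φ) ?_ (by rwa [vertices_link])
  intro u hu
  rw [vertices_link] at hu
  have hdis : Disjoint (insert u ∅ : Finset V) S := by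
    simpa using (mem_linkVertices.1 hu).1
  have hun : (insert u ∅ : Finset V) ∪ S = insert u S := by
    rw [insert_union, empty_union]
  rw [vertexSum, linkWeight, linkSum_link X hS hdis, linkSum_link X hS hdis, hun, ← vertexSum,
    ← linkWeight, hφ u hu, Nat.cast_sub (by omega)]
  ring

theorem hasGap_of_expander (hS : X.IsFace S) (hSk : S.card + 2 ≤ k) {lam : ℝ} (hlam : 0 ≤ lam)
    (hX : (X.link S hS).IsTwoSidedSpectralExpander lam) :
    HasGap X.facets X.prob k S lam := by
  refine hasGap_of_eigenvalue_le X.card_of_mem X.prob_pos hSk hlam ?_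
  intro γ φ h1 h2 ⟨u, hu, hu0⟩
  refine X.eigenvalue_link_le hS hSk hX h1 ?_
  by_contra! hc
  rw [← sum_linkWeight_insert, sum_congr rfl
    (g := fun w => linkWeight X.facets X.prob (insert w S) * φ u)
    (fun w hw => by rw [hc w hw u hu]), ← sum_mul] at h2
  exact mul_ne_zero (sum_pos (fun w hw => linkWeight_insert_pos X.prob_pos hw) ⟨u, hu⟩).ne' hu0 h2

/-- A function constant along the edges is an eigenfunction for the eigenvalue `1`. -/
theorem linkConnected_of_expander (hS : X.IsFace S) (hSk : S.card + 2 ≤ k) {lam : ℝ}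
    (hlam : lam < 1) (hX : (X.link S hS).IsTwoSidedSpectralExpander lam) :
    LinkConnected X.facets S := by
  intro φ hφ
  by_contra! hc
  refine absurd (X.eigenvalue_link_le hS hSk hX (γ := 1) (φ := φ) ?_ hc) (not_le.2 hlam)
  intro u hu
  have hcard : ((insert u S).card : ℝ) = S.card + 1 := by
    rw [card_insert_of_notMem (mem_linkVertices.1 hu).1]; push_cast; ring
  have h : vertexSum X.facets X.prob (insert u S) φ =
      vertexSum X.facets X.prob (insert u S) fun _ => φ u := by
    refine linkSum_congr fun t ht hut => sum_congr rfl fun v hv => ?_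
    have hSt := (subset_insert u S).trans hut
    refine hφ t ht hSt v ?_ u (mem_sdiff.2 ⟨hut (mem_insert_self u S), ?_⟩)
    · exact sdiff_subset_sdiff Subset.rfl (subset_insert u S) hv
    · exact (mem_linkVertices.1 hu).1
  rw [h, vertexSum_const X.card_of_mem, hcard]
  ring

end WeightedComplex

end Base

/-! ### Moment generating functions and variance -/

section MomentGenerating

/-- If the variance of `A` under each exponential tilt `exp (t * A)`, `0 ≤ t ≤ T`, is at most `C`,
then the moment generating function of `A` is bounded as for a Gaussian of variance `C`: the
variance is the second derivative of the logarithm of the moment generating function. It suffices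
to bound the second moment about some point `m`. -/
theorem sum_mul_exp_le_of_variance_le {ι : Type*} (F : Finset ι) (p A : ι → ℝ)
    (hp : ∀ i ∈ F, 0 < p i) (hp1 : ∑ i ∈ F, p i = 1) {C T : ℝ}
    (H : ∀ t ∈ Set.Icc 0 T, ∃ m : ℝ, ∑ i ∈ F, p i * Real.exp (t * A i) * (A i - m) ^ 2 ≤
      C * ∑ i ∈ F, p i * Real.exp (t * A i)) {t : ℝ} (ht : t ∈ Set.Icc 0 T) :
    ∑ i ∈ F, p i * Real.exp (t * A i) ≤
      Real.exp ((∑ i ∈ F, p i * A i) * t + C * t ^ 2 / 2) := by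
  set Z : ℝ → ℝ := fun t => ∑ i ∈ F, p i * Real.exp (t * A i) with hZ
  set Z' : ℝ → ℝ := fun t => ∑ i ∈ F, p i * Real.exp (t * A i) * A i with hZ'
  set Z'' : ℝ → ℝ := fun t => ∑ i ∈ F, p i * Real.exp (t * A i) * A i ^ 2 with hZ''
  set M := ∑ i ∈ F, p i * A i with hM
  have hne : F.Nonempty := by
    rw [nonempty_iff_ne_empty]
    rintro rfl
    simp at hp1
  have hpos : ∀ t, 0 < Z t := fun t => sum_pos (fun i hi => mul_pos (hp i hi) (Real.exp_pos _)) hne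
  have hexp : ∀ (i : ι) (t : ℝ), HasDerivAt (fun t => Real.exp (t * A i))
      (Real.exp (t * A i) * A i) t := fun i t => by
    simpa using ((hasDerivAt_id t).mul_const (A i)).exp
  have hd1 : ∀ t, HasDerivAt Z (Z' t) t := by
    intro t
    have := HasDerivAt.fun_sum (u := F) fun i _ => (hexp i t).const_mul (p i)
    simpa only [hZ, hZ', mul_assoc] using this
  have hd2 : ∀ t, HasDerivAt Z' (Z'' t) t := by
    intro t
    have := HasDerivAt.fun_sum (u := F) fun i _ =>
      ((hexp i t).const_mul (p i)).mul_const (A i)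
    simpa only [hZ', hZ'', mul_assoc, pow_two] using this
  have hvar : ∀ t ∈ Set.Icc 0 T, Z'' t * Z t - Z' t * Z' t ≤ C * Z t ^ 2 := by
    intro t ht
    obtain ⟨m, hm⟩ := H t ht
    have h : ∑ i ∈ F, p i * Real.exp (t * A i) * (A i - m) ^ 2 =
        Z'' t - 2 * m * Z' t + m ^ 2 * Z t := by
      simp only [hZ, hZ', hZ'', mul_sum]
      rw [← sum_sub_distrib, ← sum_add_distrib]
      exact sum_congr rfl fun i _ => by ring
    rw [h] at hm
    have := mul_le_mul_of_nonneg_right hm (hpos t).le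
    nlinarith [sq_nonneg (Z' t - m * Z t)]
  have hd3 : ∀ t, HasDerivAt (fun t => Z' t / Z t - C * t)
      ((Z'' t * Z t - Z' t * Z' t) / Z t ^ 2 - C) t := fun t =>
    (((hd2 t).div (hd1 t) (hpos t).ne').sub ((hasDerivAt_id t).const_mul C)).congr_deriv (by simp)
  have hanti : AntitoneOn (fun t => Z' t / Z t - C * t) (Set.Icc 0 T) := by
    refine antitoneOn_of_deriv_nonpos (convex_Icc 0 T)
      (fun t _ => (hd3 t).continuousAt.continuousWithinAt)
      (fun t _ => (hd3 t).differentiableAt.differentiableWithinAt) fun t ht => ?_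
    rw [(hd3 t).deriv, sub_nonpos, div_le_iff₀ (pow_pos (hpos t) 2)]
    exact hvar t (interior_subset ht)
  have hZ0 : Z 0 = 1 := by simpa [hZ] using hp1
  have hZ'0 : Z' 0 = M := by simp [hZ', hM]
  have h0 : (0 : ℝ) ∈ Set.Icc 0 T := ⟨le_rfl, ht.1.trans ht.2⟩
  have hd4 : ∀ t, HasDerivAt (fun t => Real.log (Z t) - (M * t + C * t ^ 2 / 2))
      (Z' t / Z t - (M + C * t)) t := fun t => by
    have h2 : HasDerivAt (fun t : ℝ => M * t + C * t ^ 2 / 2) (M + C * t) t :=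
      (((hasDerivAt_id' t).const_mul M).add
        ((((hasDerivAt_id' t).pow 2).const_mul C).div_const 2)).congr_deriv (by simp; ring)
    exact ((hd1 t).log (hpos t).ne').sub h2
  have hanti2 : AntitoneOn (fun t => Real.log (Z t) - (M * t + C * t ^ 2 / 2)) (Set.Icc 0 T) := by
    refine antitoneOn_of_deriv_nonpos (convex_Icc 0 T)
      (fun t _ => (hd4 t).continuousAt.continuousWithinAt)
      (fun t _ => (hd4 t).differentiableAt.differentiableWithinAt) fun t ht => ?_
    rw [(hd4 t).deriv]
    have h := hanti h0 (interior_subset ht) (interior_subset ht).1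
    simp only [hZ0, hZ'0, div_one, mul_zero, sub_zero] at h
    linarith
  have h := hanti2 h0 ht ht.1
  simp only [hZ0, Real.log_one, mul_zero, ne_eq, OfNat.ofNat_ne_zero, not_false_eq_true, zero_pow,
    zero_div, add_zero, sub_self] at h
  refine (Real.exp_log (hpos t)).symm.trans_le ?_
  exact Real.exp_le_exp.2 (by linarith)

end MomentGenerating

section Variance

variable {V : Type*} [DecidableEq V] {F : Finset (Finset V)} {p : Finset V → ℝ} {k : ℕ}

theorem linkSum_empty (G : Finset V → ℝ) : linkSum F p ∅ G = ∑ t ∈ F, p t * G t := by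
  simp [linkSum]

/-- A gap of order `1 / k` makes the variance of a sum of bounded vertex values linear in `k`. -/
theorem exists_sum_sq_le_of_hasGap (hF : ∀ t ∈ F, t.card = k) (hp : ∀ t ∈ F, 0 < p t)
    (hne : F.Nonempty) (hk : 1 ≤ k) (H : HasGap F p k ∅ (2 / k)) {f : V → ℝ} {a : ℝ}
    (hf : ∀ v ∈ linkVertices F ∅, f v ∈ Set.Icc a (a + 1)) :
    ∃ m : ℝ, ∑ t ∈ F, p t * (∑ v ∈ t, f v - m) ^ 2 ≤ 3 * k * ∑ t ∈ F, p t := by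
  have hk0 : (1 : ℝ) ≤ k := by exact_mod_cast hk
  have hw : 0 < linkWeight F p ∅ := by
    obtain ⟨t, ht⟩ := hne
    exact linkWeight_pos hp ⟨t, ht, empty_subset t⟩
  set w := linkWeight F p ∅ with hwdef
  have hmem : ∀ t ∈ F, ∀ v ∈ t, f v ∈ Set.Icc a (a + 1) := fun t ht v hv =>
    hf v (mem_biUnion.2 ⟨t, by simpa using ht, by simpa using hv⟩)
  set m := vertexSum F p ∅ f / (k * w) with hm
  have hmw : k * w * m = vertexSum F p ∅ f := mul_div_cancel₀ _ (by positivity)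
  have hconst : ∀ c : ℝ, vertexSum F p ∅ (fun _ => c) = k * w * c := fun c => by
    rw [vertexSum_const hF, card_empty]; push_cast; ring
  have hma : a ≤ m := by
    have h : vertexSum F p ∅ (fun _ => a) ≤ vertexSum F p ∅ f :=
      linkSum_le hp fun t ht _ => sum_le_sum fun v hv => (hmem t ht v (by simpa using hv)).1
    rw [hconst, ← hmw] at h
    exact le_of_mul_le_mul_left h (by positivity)
  have hma' : m ≤ a + 1 := by
    have h : vertexSum F p ∅ f ≤ vertexSum F p ∅ (fun _ => a + 1) :=
      linkSum_le hp fun t ht _ => sum_le_sum fun v hv => (hmem t ht v (by simpa using hv)).2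
    rw [hconst, ← hmw] at h
    exact le_of_mul_le_mul_left h (by positivity)
  have hmean : vertexSum F p ∅ (fun u => f u + -m) = 0 := by
    rw [vertexSum_add, hconst]; linarith
  have hgap := H _ hmean
  have hsq : vertexSum F p ∅ (fun u => (f u + -m) ^ 2) ≤ k * w := by
    have h : vertexSum F p ∅ (fun u => (f u + -m) ^ 2) ≤ vertexSum F p ∅ (fun _ => 1) := by
      refine linkSum_le hp fun t ht _ => sum_le_sum fun v hv => ?_
      have := hmem t ht v (by simpa using hv)
      rw [sq_le_one_iff_abs_le_one, abs_le]
      constructor <;> linarith [this.1, this.2]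
    rwa [hconst, mul_one] at h
  refine ⟨k * m, ?_⟩
  have hdecomp : ∑ t ∈ F, p t * (∑ v ∈ t, f v - k * m) ^ 2 =
      vertexSum F p ∅ (fun u => (f u + -m) ^ 2) +
        pairSum F p ∅ (fun u v => (f u + -m) * (f v + -m)) := by
    rw [vertexSum, pairSum, ← linkSum_add, linkSum_empty]
    refine sum_congr rfl fun t ht => ?_
    have h1 : ∑ v ∈ t, f v - k * m = ∑ v ∈ t, (f v + -m) := by
      rw [sum_add_distrib, sum_const, hF t ht, nsmul_eq_mul]; ring
    rw [h1, pow_two, sum_mul_sum, ← sum_add_distrib]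
    congr 1
    refine sum_congr rfl fun u hu => ?_
    rw [← add_sum_erase t _ hu, pow_two]
  have hwsum : w = ∑ t ∈ F, p t := by
    rw [hwdef, linkWeight, linkSum_empty]; simp
  rw [hdecomp, ← hwsum]
  rw [card_empty, Nat.cast_zero, sub_zero] at hgap
  have h2 : 2 / (k : ℝ) * (((k : ℝ) - 1) * vertexSum F p ∅ (fun u => (f u + -m) ^ 2)) ≤
      2 / (k : ℝ) * (((k : ℝ) - 1) * (k * w)) := by
    have : (0 : ℝ) ≤ k - 1 := by linarith
    gcongr
  have h3 : 2 / (k : ℝ) * (((k : ℝ) - 1) * (k * w)) = 2 * (k - 1) * w := by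
    field_simp
  nlinarith

end Variance

/-! ### Concentration of the average over a facet -/

section Concentration

variable {V : Type*} [DecidableEq V] {k : ℕ}

namespace WeightedComplex

/-- The tilted complex inherits a spectral gap in all of its links. The links of codimension two
have a gap because tilting changes their eigenvalues by a bounded factor, and the gap trickles down
from there. -/
theorem hasGap_expTilt (X : WeightedComplex V k) {lam : ℝ} (hlam : 0 ≤ lam)
    (hlamk : lam * (2 * k) ≤ 1) (hX : X.IsTwoSidedLocalSpectralExpander lam) {f : V → ℝ} {a : ℝ}
    (hf : ∀ v ∈ X.vertices, f v ∈ Set.Icc a (a + 1)) {s : ℝ} (hs : s ∈ Set.Icc (0 : ℝ) (1 / 6))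
    (n : ℕ) : ∀ S : Finset V, X.IsFace S → S.card + 2 + n = k →
      HasGap X.facets (expTilt X.prob s f) k S (1 / ((k : ℝ) / 2 + S.card)) := by
  have hexp : Real.exp s ≤ 6 / 5 := by
    have h1 : Real.exp s ≤ Real.exp (1 / 6) := Real.exp_le_exp.2 hs.2
    have h2 := Real.add_one_le_exp (-(1 / 6) : ℝ)
    have h3 : Real.exp (1 / 6) * Real.exp (-(1 / 6)) = 1 := by rw [← Real.exp_add]; simp
    nlinarith [Real.exp_pos (1 / 6)]
  have hp' := expTilt_pos X.prob_pos s f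
  induction n with
  | zero =>
    intro S hS hSk
    have hk2 : (k : ℝ) = S.card + 2 := by rw [← hSk]; push_cast; ring
    have hS0 : (0 : ℝ) ≤ S.card := Nat.cast_nonneg _
    have hle : lam * Real.exp s * ((k : ℝ) / 2 + S.card) ≤ 1 := by
      have h1 : lam * Real.exp s ≤ lam * (6 / 5) := mul_le_mul_of_nonneg_left hexp hlam
      have h2 : lam * Real.exp s * ((k : ℝ) / 2 + S.card) ≤
          lam * (6 / 5) * ((k : ℝ) / 2 + S.card) :=
        mul_le_mul_of_nonneg_right h1 (by linarith)
      nlinarith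
    have hle1 : lam * Real.exp s ≤ 1 := by
      have : 0 ≤ lam * Real.exp s := mul_nonneg hlam (Real.exp_pos s).le
      nlinarith
    refine HasGap.mono hp' (by omega) ((le_div_iff₀ (by linarith)).2 hle) ?_
    refine HasGap.tilt X.card_of_mem X.prob_pos (by omega) hS hlam hs.1 hle1 ?_
      (X.hasGap_of_expander hS (by omega) hlam (hX S hS (by omega)))
    intro u hu v hv
    have hmem : ∀ x ∈ linkVertices X.facets S, x ∈ X.vertices := by
      intro x hx
      obtain ⟨t, ht, hxt⟩ := mem_biUnion.1 hx
      exact mem_biUnion.2 ⟨t, (mem_filter.1 ht).1, (mem_sdiff.1 hxt).1⟩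
    have h1 := hf u (hmem u hu)
    have h2 := hf v (hmem v hv)
    linarith [h1.2, h2.1]
  | succ n ih =>
    intro S hS hSk
    have hk3 : (3 : ℝ) ≤ k := by exact_mod_cast (by omega : 3 ≤ k)
    have hS0 : (0 : ℝ) ≤ S.card := Nat.cast_nonneg _
    have hlam1 : lam < 1 := by nlinarith
    have hD : 0 < (k : ℝ) / 2 + (S.card + 1) := by linarith
    have h := hasGap_of_hasGap_insert (θ := 1 / ((k : ℝ) / 2 + (S.card + 1))) X.card_of_mem hp'
      (by omega) (by positivity) (by rw [div_lt_one hD]; linarith)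
      (fun w hw => by
        have hc := card_insert_of_notMem (mem_linkVertices.1 hw).1
        have := ih (insert w S) (mem_linkVertices.1 hw).2 (by omega)
        rw [hc] at this
        push_cast at this
        exact this)
      (X.linkConnected_of_expander hS (by omega) hlam1 (hX S hS (by omega)))
    have heq : 1 / ((k : ℝ) / 2 + (S.card + 1)) / (1 - 1 / ((k : ℝ) / 2 + (S.card + 1))) =
        1 / ((k : ℝ) / 2 + S.card) := by
      have h1 : (k : ℝ) / 2 + S.card ≠ 0 := by linarith
      rw [one_sub_div hD.ne', div_div_div_cancel_right₀ hD.ne']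
      congr 1
      ring
    rwa [heq] at h

theorem facets_nonempty (X : WeightedComplex V k) : X.facets.Nonempty := by
  rw [nonempty_iff_ne_empty]
  intro h
  have := X.prob_sum
  simp [h] at this

theorem hasGap_expTilt_empty (X : WeightedComplex V k) (hk : 1 ≤ k) {lam : ℝ} (hlam : 0 ≤ lam)
    (hlamk : lam * (2 * k) ≤ 1) (hX : X.IsTwoSidedLocalSpectralExpander lam) {f : V → ℝ} {a : ℝ}
    (hf : ∀ v ∈ X.vertices, f v ∈ Set.Icc a (a + 1)) {s : ℝ}
    (hs : s ∈ Set.Icc (0 : ℝ) (1 / 6)) :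
    HasGap X.facets (expTilt X.prob s f) k ∅ (2 / k) := by
  rcases hk.eq_or_lt with rfl | hk2
  · -- there are no pairs of distinct vertices in a facet of size one
    intro φ _
    have : pairSum X.facets (expTilt X.prob s f) ∅ (fun u v => φ u * φ v) = 0 := by
      refine sum_eq_zero fun t ht => ?_
      obtain ⟨v, hv⟩ := card_eq_one.1 (X.card_of_mem t (mem_filter.1 ht).1)
      simp [hv]
    rw [this]
    simp
  · obtain ⟨t, ht⟩ := X.facets_nonempty
    have h := X.hasGap_expTilt hlam hlamk hX hf hs (k - 2) ∅ ⟨t, ht, empty_subset t⟩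
      (by rw [card_empty]; omega)
    rwa [card_empty, Nat.cast_zero, add_zero, one_div_div] at h

theorem mul_vertexMean (X : WeightedComplex V k) (hk : 1 ≤ k) (f : V → ℝ) :
    (k : ℝ) * X.vertexMean f = ∑ s ∈ X.facets, X.prob s * ∑ v ∈ s, f v := by
  have hk0 : (k : ℝ) ≠ 0 := by positivity
  rw [← linkSum_empty (F := X.facets) (p := X.prob) (fun s => ∑ v ∈ s, f v), ← vertexSum,
    ← sum_linkWeight_insert, linkVertices_empty, vertexMean, mul_sum]
  refine sum_congr rfl fun v _ => ?_
  rw [density_eq_linkWeight, Nat.choose_one_right, insert_empty_eq]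
  field_simp

/-- A one-sided Chernoff bound with exponent linear in `k`, for an expansion parameter of order
`1 / k`. -/
theorem facetProb_gt_le (X : WeightedComplex V k) (hk : 1 ≤ k) {lam : ℝ} (hlam : 0 ≤ lam)
    (hlamk : lam * (2 * k) ≤ 1) (hX : X.IsTwoSidedLocalSpectralExpander lam) {f : V → ℝ} {a : ℝ}
    (hf : ∀ v ∈ X.vertices, f v ∈ Set.Icc a (a + 1)) {ε : ℝ} (hε : 0 < ε) :
    X.facetProb (fun s => (1 / (k : ℝ)) * ∑ v ∈ s, f v - X.vertexMean f > ε) ≤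
      Real.exp (-(1 / 12) * ε ^ 2 * k) := by
  have hk0 : (0 : ℝ) < k := by positivity
  have hmem : ∀ t ∈ X.facets, ∀ v ∈ t, v ∈ X.vertices := fun t ht v hv =>
    mem_biUnion.2 ⟨t, ht, hv⟩
  set M := ∑ s ∈ X.facets, X.prob s * ∑ v ∈ s, f v with hM
  have hμ : X.vertexMean f = M / k := by
    rw [hM, ← X.mul_vertexMean hk, mul_div_cancel_left₀ _ hk0.ne']
  have hevent : ∀ s, (1 / (k : ℝ)) * ∑ v ∈ s, f v - X.vertexMean f > ε →
      0 ≤ ∑ v ∈ s, f v - (M + ε * k) := by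
    intro s hs
    rw [hμ, one_div_mul_eq_div, ← sub_div, gt_iff_lt, lt_div_iff₀ hk0] at hs
    linarith
  rcases le_or_gt ε 1 with hε1 | hε1
  · have ht : ε / 6 ∈ Set.Icc (0 : ℝ) (1 / 6) := ⟨by linarith, by linarith⟩
    have hmgf := sum_mul_exp_le_of_variance_le X.facets X.prob (fun s => ∑ v ∈ s, f v)
      X.prob_pos X.prob_sum (C := 3 * k) (T := 1 / 6) (fun t ht =>
        exists_sum_sq_le_of_hasGap X.card_of_mem (expTilt_pos X.prob_pos t f) X.facets_nonempty hk
          (X.hasGap_expTilt_empty hk hlam hlamk hX hf ht)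
          (by rwa [linkVertices_empty])) ht
    rw [← hM] at hmgf
    calc X.facetProb _
        ≤ ∑ s ∈ X.facets, X.prob s * Real.exp (ε / 6 * (∑ v ∈ s, f v - (M + ε * k))) := by
          rw [facetProb, sum_filter]
          refine sum_le_sum fun s hs => ?_
          split_ifs with h
          · refine le_mul_of_one_le_right (X.prob_pos s hs).le (Real.one_le_exp ?_)
            exact mul_nonneg ht.1 (hevent s h)
          · exact mul_nonneg (X.prob_pos s hs).le (Real.exp_pos _).le
      _ = (∑ s ∈ X.facets, X.prob s * Real.exp (ε / 6 * ∑ v ∈ s, f v)) *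
            Real.exp (-(ε / 6 * (M + ε * k))) := by
          rw [sum_mul]
          refine sum_congr rfl fun s _ => ?_
          rw [mul_assoc, ← Real.exp_add]
          ring_nf
      _ ≤ Real.exp (M * (ε / 6) + 3 * k * (ε / 6) ^ 2 / 2) *
            Real.exp (-(ε / 6 * (M + ε * k))) :=
          mul_le_mul_of_nonneg_right hmgf (Real.exp_pos _).le
      _ ≤ _ := by
          rw [← Real.exp_add]
          refine Real.exp_le_exp.2 ?_
          have : 0 ≤ ε ^ 2 * k := by positivity
          nlinarith
  · -- the average never exceeds its mean by more than one
    have hzero : X.facetProb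
        (fun s => (1 / (k : ℝ)) * ∑ v ∈ s, f v - X.vertexMean f > ε) = 0 := by
      rw [facetProb, sum_filter]
      refine sum_eq_zero fun s hs => if_neg fun h => ?_
      have h1 : ∑ v ∈ s, f v ≤ k * (a + 1) := by
        have := sum_le_card_nsmul s f (a + 1) fun v hv => (hf v (hmem s hs v hv)).2
        rwa [X.card_of_mem s hs, nsmul_eq_mul] at this
      have h2 : k * a ≤ M := by
        calc k * a = ∑ s ∈ X.facets, X.prob s * (k * a) := by
              rw [← sum_mul, X.prob_sum, one_mul]
          _ ≤ M := by
              refine sum_le_sum fun t ht => mul_le_mul_of_nonneg_left ?_ (X.prob_pos t ht).le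
              have := card_nsmul_le_sum t f a fun v hv => (hf v (hmem t ht v hv)).1
              rwa [X.card_of_mem t ht, nsmul_eq_mul] at this
      have h3 := hevent s h
      nlinarith
    rw [hzero]
    exact (Real.exp_pos _).le

end WeightedComplex

theorem one_le_chernoffCoeff {k : ℕ} (hk : 1 ≤ k) {α : ℝ} (hα : 0 ≤ α) :
    1 ≤ chernoffCoeff k α := by
  have hk' : (1 : ℝ) ≤ k := by exact_mod_cast hk
  rw [chernoffCoeff]
  split_ifs
  · exact hk'
  · exact le_min hk' (Real.one_le_exp (by positivity))

end Concentration

theorem mainTheorem4 {V : Type*} [DecidableEq V] (k : ℕ) (hk : 1 ≤ k)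
    (α : ℝ) (hα : α ∈ Set.Icc (0 : ℝ) 1)
    (X : WeightedComplex V k)
    (hX : X.IsTwoSidedLocalSpectralExpander ((1 / (k : ℝ)) * (2 : ℝ) ^ (-((k : ℝ) ^ α))))
    (f : V → ℝ) (hf : ∀ v ∈ X.vertices, f v ∈ Set.Icc (0 : ℝ) 1)
    (ε : ℝ) (hε : 0 < ε) :
    X.facetProb (fun s => (1 / (k : ℝ)) * ∑ v ∈ s, f v - X.vertexMean f > ε) ≤
        2 * chernoffCoeff k α *
          Real.exp (-(1 / 12) * ε ^ 2 * (k : ℝ) ^ ((1 + α) / 2)) ∧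
      X.facetProb (fun s => (1 / (k : ℝ)) * ∑ v ∈ s, f v - X.vertexMean f < -ε) ≤
        2 * chernoffCoeff k α *
          Real.exp (-(1 / 12) * ε ^ 2 * (k : ℝ) ^ ((1 + α) / 2)) := by
  have hk' : (1 : ℝ) ≤ k := by exact_mod_cast hk
  have hlam : 0 ≤ (1 / (k : ℝ)) * (2 : ℝ) ^ (-((k : ℝ) ^ α)) := by positivity
  have hlamk : (1 / (k : ℝ)) * (2 : ℝ) ^ (-((k : ℝ) ^ α)) * (2 * k) ≤ 1 := by
    have h1 : (2 : ℝ) ^ (-((k : ℝ) ^ α)) ≤ 2 ^ (-1 : ℝ) :=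
      Real.rpow_le_rpow_of_exponent_le one_le_two
        (neg_le_neg (Real.one_le_rpow hk' hα.1))
    rw [Real.rpow_neg_one] at h1
    have h2 : (1 / (k : ℝ)) * (2 : ℝ) ^ (-((k : ℝ) ^ α)) * (2 * k) =
        2 * (2 : ℝ) ^ (-((k : ℝ) ^ α)) := by
      field_simp
    rw [h2]
    linarith
  have hbound : Real.exp (-(1 / 12) * ε ^ 2 * k) ≤ 2 * chernoffCoeff k α *
      Real.exp (-(1 / 12) * ε ^ 2 * (k : ℝ) ^ ((1 + α) / 2)) := by
    have h1 : (k : ℝ) ^ ((1 + α) / 2) ≤ k := by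
      conv_rhs => rw [← Real.rpow_one (k : ℝ)]
      exact Real.rpow_le_rpow_of_exponent_le hk' (by linarith [hα.2])
    have h2 : Real.exp (-(1 / 12) * ε ^ 2 * k) ≤
        Real.exp (-(1 / 12) * ε ^ 2 * (k : ℝ) ^ ((1 + α) / 2)) := by
      refine Real.exp_le_exp.2 ?_
      have := mul_le_mul_of_nonneg_left h1 (sq_nonneg ε)
      linarith
    refine h2.trans (le_mul_of_one_le_left (Real.exp_pos _).le ?_)
    linarith [one_le_chernoffCoeff hk hα.1]
  constructor
  · exact (X.facetProb_gt_le hk hlam hlamk hX (a := 0) (by simpa using hf) hε).trans hbound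
  · have h := X.facetProb_gt_le hk hlam hlamk hX (f := fun v => -f v) (a := -1)
      (fun v hv => ⟨by linarith [(hf v hv).2], by linarith [(hf v hv).1]⟩) hε
    have hevent : (fun s : Finset V => (1 / (k : ℝ)) * ∑ v ∈ s, f v - X.vertexMean f < -ε) =
        fun s => (1 / (k : ℝ)) * ∑ v ∈ s, -f v - X.vertexMean (fun v => -f v) > ε := by
      funext s
      simp only [WeightedComplex.vertexMean, mul_neg, sum_neg_distrib, gt_iff_lt, eq_iff_iff]
      constructor <;> intro h <;> linarith
    rw [hevent]
    exact h.trans hbound
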